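/- Let $F$ be an algebraically closed field of characteristic zero (for instance $F=\mathbb C$) and $K=F(x,y)$. For a finite extension $M$ of $K$ let $M'$ be the space of one-forms $P\,dx+Q\,dy$ with $P,Q\in M$; the differential $d$ of $K$ extends uniquely to $M$, $K'\subseteq M'$, and $K$-automorphisms $\sigma$ of $M$ act on $M'$ by $\sigma(a\,db)=\sigma(a)\,d\sigma(b)$. We say that $\omega\in K'$ satisfies an elementary relation over $M$ if there are $v\in M$, $u_1,\dots,u_m\in M^*$ and $c_1,\dots,c_m\in F$ with $$\Bigl(dv+\sum_i c_i\frac{du_i}{u_i}\Bigr)\wedge\omega=0,\qquad dv+\sum_i c_i\frac{du_i}{u_i}\neq 0 .$$ The form $\omega\in K'$ is *exceptional* if it satisfies an elementary relation over some finite extension of $K$ but none over $K$ itself. It admits a rational first integral if $df\wedge\omega=0$ for some $f\in K\setminus F$. Let $n>1$, let $L=K(\ell)$ be a Galois extension of $K$ of degree $n$ whose Galois group is cyclic with generator $\tau$, and suppose that $\tau(\ell)=\zeta\ell$ with a primitive $n$-th root of unity $\zeta\in F$. Define $\mathrm{Pr}:L'\to L'$ by $\mathrm{Pr}(\xi)=\frac1n\sum_{j=0}^{n-1}\zeta^{-j}\tau^j(\xi)$.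 (a) Let $\tilde\gamma=d\tilde v+\sum_i\tilde c_i\,d\tilde u_i/\tilde u_i$ with $\tilde v\in L$ of trace zero, all $\tilde u_i\in L^*$ of norm one (trace and norm of $L/K$), and $\tilde c_i\in F$. Then $\gamma:=\mathrm{Pr}(\tilde\gamma)$ is again of the form $\gamma=dv+\sum_i c_i\,du_i/u_i$ with $v\in L$ of trace zero, all $u_i\in L^*$ of norm one, and $c_i\in F$; furthermore $\gamma=\ell\,\omega$ for some $\omega\in K'$. (b) If, in (a), $\omega$ does not admit a rational first integral, then $\omega$ is exceptional. (c) Every exceptional form arises in this way. Precisely: if $\omega\in K'$ is exceptional and $\ell\,\omega=dv+\sum_i c_i\,du_i/u_i$ for some $v\in L$, $u_i\in L^*$, $c_i\in F$, then $\ell\,\omega=\mathrm{Pr}(\tilde\gamma)$ for some $\tilde\gamma$ as in (a). Moreover, for every exceptional $\omega\in K'$ there are $n>1$, $\zeta$, $L=K(\ell)$ and $\tau$ as above, and $\tilde\gamma\in L'$ as in (a), with $\mathrm{Pr}(\tilde\gamma)=\ell\,\omega$. -/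

import Mathlib

open scoped KaehlerDifferential IntermediateField TensorProduct

universe u v w

noncomputable section

namespace ElemInt

/-- The field `K = F(x, y)` of rational functions in two variables over `F`. -/
abbrev RatFun (F : Type u) [Field F] : Type u :=
  FractionRing (MvPolynomial (Fin 2) F)

/-! One-forms over an extension field `M` of `K` are the Kähler differentials `Ω[M⁄F]`. For `M`
finite over `K` this is the two-dimensional `M`-vector space with basis `dx, dy`, and
`KaehlerDifferential.D F M` is the unique extension of the usual differential `d` on `K`. -/

/-- The pull-back of one-forms along a homomorphism of `F`-algebras:
`a db ↦ f(a) d(f(b))`. -/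
def formMap (F : Type u) {A : Type v} {B : Type w} [CommRing F] [CommRing A] [CommRing B]
    [Algebra F A] [Algebra F B] (f : A →ₐ[F] B) : Ω[A⁄F] →ₗ[F] Ω[B⁄F] :=
  Ideal.mapCotangent (KaehlerDifferential.ideal F A) (KaehlerDifferential.ideal F B)
    (Algebra.TensorProduct.map f f) (by
      have key : ∀ z, Algebra.TensorProduct.lmul' F (S := B) (Algebra.TensorProduct.map f f z)
          = f (Algebra.TensorProduct.lmul' F (S := A) z) := by
        intro z
        induction z with
        | zero => simp
        | add a b ha hb => simp only [map_add, ha, hb]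
        | tmul a b => simp
      intro z hz
      have hz' : Algebra.TensorProduct.lmul' F (S := A) z = 0 := hz
      change Algebra.TensorProduct.lmul' F (S := B) (Algebra.TensorProduct.map f f z) = 0
      rw [key, hz', map_zero])

theorem formMap_D (F : Type u) {A : Type v} {B : Type w} [CommRing F] [CommRing A] [CommRing B]
    [Algebra F A] [Algebra F B] (f : A →ₐ[F] B) (b : A) :
    formMap F f (KaehlerDifferential.D F A b) = KaehlerDifferential.D F B (f b) := by
  rw [KaehlerDifferential.D_apply, KaehlerDifferential.D_apply]
  unfold formMap
  erw [Ideal.mapCotangent_toCotangent]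
  congr 1
  apply Subtype.ext
  simp

theorem formMap_smul (F : Type u) {A : Type v} {B : Type w} [CommRing F] [CommRing A]
    [CommRing B] [Algebra F A] [Algebra F B] (f : A →ₐ[F] B) (a : A) (ξ : Ω[A⁄F]) :
    formMap F f (a • ξ) = f a • formMap F f ξ := by
  obtain ⟨z, rfl⟩ := Ideal.toCotangent_surjective _ ξ
  have hA : a • (KaehlerDifferential.ideal F A).toCotangent z
      = (KaehlerDifferential.ideal F A).toCotangent ((a ⊗ₜ[F] (1 : A)) • z) := by
    rw [map_smul]
    exact (algebraMap_smul (TensorProduct F A A) a _).symm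
  have hB : ∀ y, f a • (KaehlerDifferential.ideal F B).toCotangent y
      = (KaehlerDifferential.ideal F B).toCotangent ((f a ⊗ₜ[F] (1 : B)) • y) := by
    intro y
    rw [map_smul]
    exact (algebraMap_smul (TensorProduct F B B) (f a) _).symm
  unfold formMap
  erw [hA, Ideal.mapCotangent_toCotangent, Ideal.mapCotangent_toCotangent, hB]
  congr 1
  apply Subtype.ext
  simp

/-- The vanishing of the wedge product `α ∧ β` of two one-forms over `M`. -/
def WedgeEqZero (F : Type u) {M : Type v} [Field F] [Field M] [Algebra F M]
    (α β : Ω[M⁄F]) : Prop :=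
  ExteriorAlgebra.ι M α * ExteriorAlgebra.ι M β = 0

/-- The one-form `dv + ∑ cᵢ duᵢ / uᵢ`. -/
def elemForm {F : Type u} {M : Type v} [Field F] [Field M] [Algebra F M] {m : ℕ}
    (v : M) (c : Fin m → F) (u : Fin m → Mˣ) : Ω[M⁄F] :=
  KaehlerDifferential.D F M v
    + ∑ i, c i • ((u i : M)⁻¹ • KaehlerDifferential.D F M (u i : M))

section Extension

variable (F : Type u) [Field F] (M : Type v) [Field M] [Algebra F M] [Algebra (RatFun F) M]
  [IsScalarTower F (RatFun F) M]

/-- A one-form over `K`, regarded as a one-form over the extension field `M`. -/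
def extendForm (ω : Ω[RatFun F⁄F]) : Ω[M⁄F] :=
  KaehlerDifferential.map F F (RatFun F) M ω

/-- There are `v ∈ M`, `uᵢ ∈ Mˣ` and constants `cᵢ` with
`(dv + ∑ cᵢ duᵢ / uᵢ) ∧ ω = 0` and `dv + ∑ cᵢ duᵢ / uᵢ ≠ 0`. -/
def HasElementaryRelation (ω : Ω[RatFun F⁄F]) : Prop :=
  ∃ (m : ℕ) (v : M) (c : Fin m → F) (u : Fin m → Mˣ),
    elemForm v c u ≠ 0 ∧ WedgeEqZero F (elemForm v c u) (extendForm F M ω)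

end Extension

/-- `ω` has a first integral `f ∈ K`, not a constant. -/
def HasRationalFirstIntegral (F : Type u) [Field F] (ω : Ω[RatFun F⁄F]) : Prop :=
  ∃ f : RatFun F, f ∉ Set.range (algebraMap F (RatFun F)) ∧
    WedgeEqZero F (KaehlerDifferential.D F (RatFun F) f) ω

/-- `ω` is exceptional: it satisfies an elementary relation over some finite extension of `K`, but
none over `K` itself. -/
def IsExceptional (F : Type u) [Field F] (ω : Ω[RatFun F⁄F]) : Prop :=
  (∃ (M : Type u) (_ : Field M) (_ : Algebra F M) (_ : Algebra (RatFun F) M)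
      (_ : IsScalarTower F (RatFun F) M),
      FiniteDimensional (RatFun F) M ∧ HasElementaryRelation F M ω) ∧
    ¬ HasElementaryRelation F (RatFun F) ω

section Cyclic

variable {F : Type u} [Field F] {L : Type v} [Field L] [Algebra F L] [Algebra (RatFun F) L]

/-- `L = K(ℓ)` is a cyclic Galois extension of `K` of degree `n > 1`, its Galois group is
generated by `τ`, and `τ(ℓ) = ζ ℓ` with a primitive `n`-th root of unity `ζ`. -/
structure IsCyclicSetting (n : ℕ) (ζ : F) (τ : L ≃ₐ[RatFun F] L) (ℓ : L) : Prop where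
  one_lt : 1 < n
  finrank_eq : Module.finrank (RatFun F) L = n
  isGalois : IsGalois (RatFun F) L
  generates : ∀ σ : L ≃ₐ[RatFun F] L, σ ∈ Subgroup.zpowers τ
  isPrimitiveRoot : IsPrimitiveRoot ζ n
  adjoin_eq_top : (RatFun F)⟮ℓ⟯ = ⊤
  map_eq : τ ℓ = ζ • ℓ

/-- `γ = dv + ∑ cᵢ duᵢ / uᵢ` with `v ∈ L` of trace zero, all `uᵢ ∈ Lˣ` of norm one, and
constants `cᵢ`. -/
def IsTraceNormForm (γ : Ω[L⁄F]) : Prop :=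
  ∃ (m : ℕ) (v : L) (c : Fin m → F) (u : Fin m → Lˣ),
    Algebra.trace (RatFun F) L v = 0 ∧ (∀ i, Algebra.norm (RatFun F) (u i : L) = 1) ∧
      γ = elemForm v c u

/-- The map `Pr(ξ) = (1/n) ∑_{j < n} ζ⁻ʲ τʲ(ξ)` on one-forms over `L`. -/
def Pr [IsScalarTower F (RatFun F) L] (n : ℕ) (ζ : F) (τ : L ≃ₐ[RatFun F] L)
    (ξ : Ω[L⁄F]) : Ω[L⁄F] :=
  (n : F)⁻¹ • ∑ j ∈ Finset.range n,
    (ζ⁻¹) ^ j • formMap F (((τ ^ j : L ≃ₐ[RatFun F] L) : L →ₐ[RatFun F] L).restrictScalars F) ξ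

end Cyclic

end ElemInt

end

/-!
An elementary relation for `ω` over `M` is a multiplier `h ∈ Mˣ` for which `h ω` is an elementary
form `dv + ∑ cᵢ duᵢ / uᵢ`. Elementary forms are closed, so the quotient `f` of two multipliers
satisfies `df ∧ ω = 0`. The coefficients of the minimal polynomial of `f` over `K` satisfy the same
relation, hence are constants when `ω` has no first integral in `K`, and so is `f`: multipliers are
unique up to constant factors.

If `ω` is exceptional, it has a multiplier `h` in a finite Galois extension of `K`, and every
automorphism `σ` takes `h` to another multiplier, that is, to `χ(σ) h` with a constant `χ(σ)`. The
character `χ` is injective on the Galois group of `K(h)`, which is therefore cyclic, and `h` is a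
Kummer generator. Conversely, a Kummer generator `ℓ` that is a multiplier rules out multipliers in
`K`, because `ℓ` is not a constant multiple of an element of `K`.

Trace zero and norm one come from `n γ - Tr γ`, in which `v` and `u` are replaced by `n v - Tr v`
and `uⁿ / N u`; for `γ = ℓ ω` the trace of `γ` vanishes. The projection is
`Pr ξ = (1/n) ℓ Tr(ℓ⁻¹ ξ)`, and traces of forms over `L` are forms over `K`.
-/

noncomputable section

namespace ElemInt

open KaehlerDifferential

section Forms

theorem kaehlerDifferential_induction {F A : Type*} [CommRing F] [CommRing A] [Algebra F A]
    {P : Ω[A⁄F] → Prop} (zero : P 0) (add : ∀ ξ η, P ξ → P η → P (ξ + η))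
    (smul_D : ∀ a b : A, P (a • D F A b)) (ξ : Ω[A⁄F]) : P ξ := by
  have hξ : ξ ∈ Submodule.span A (Set.range (D F A)) :=
    span_range_derivation F A ▸ Submodule.mem_top
  refine Submodule.closure_induction zero (fun ξ η _ _ => add ξ η) ?_ hξ
  rintro a _ ⟨b, rfl⟩
  exact smul_D a b

theorem formMap_comp {F A B C : Type*} [CommRing F] [CommRing A] [CommRing B] [CommRing C]
    [Algebra F A] [Algebra F B] [Algebra F C] (g : B →ₐ[F] C) (f : A →ₐ[F] B) (ξ : Ω[A⁄F]) :
    formMap F g (formMap F f ξ) = formMap F (g.comp f) ξ := by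
  induction ξ using kaehlerDifferential_induction with
  | zero => simp only [map_zero]
  | add ξ η hξ hη => simp only [map_add, hξ, hη]
  | smul_D a b => simp only [formMap_smul, formMap_D, AlgHom.comp_apply]

theorem formMap_toAlgHom {F A B : Type*} [CommRing F] [CommRing A] [CommRing B] [Algebra F A]
    [Algebra F B] [Algebra A B] [IsScalarTower F A B] (ξ : Ω[A⁄F]) :
    formMap F (IsScalarTower.toAlgHom F A B) ξ = map F F A B ξ := by
  induction ξ using kaehlerDifferential_induction with
  | zero => simp only [map_zero]
  | add ξ η hξ hη => simp only [map_add, hξ, hη]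
  | smul_D a b =>
    rw [formMap_smul, formMap_D, map_smul, map_D, IsScalarTower.toAlgHom_apply,
      IsScalarTower.toAlgHom_apply, algebraMap_smul]

theorem formMap_map {F A B C : Type*} [CommRing F] [CommRing A] [CommRing B] [CommRing C]
    [Algebra F A] [Algebra F B] [Algebra F C] [Algebra A B] [Algebra A C] [IsScalarTower F A B]
    [IsScalarTower F A C] (φ : B →ₐ[A] C) (ξ : Ω[A⁄F]) :
    formMap F (φ.restrictScalars F) (map F F A B ξ) = map F F A C ξ := by
  rw [← formMap_toAlgHom, ← formMap_toAlgHom, formMap_comp]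
  congr
  ext a
  exact φ.commutes a

theorem map_self {F A : Type*} [CommRing F] [CommRing A] [Algebra F A] (ξ : Ω[A⁄F]) :
    map F F A A ξ = ξ := by
  induction ξ using kaehlerDifferential_induction with
  | zero => simp only [map_zero]
  | add ξ η hξ hη => simp only [map_add, hξ, hη]
  | smul_D a b => rw [map_smul, map_D, Algebra.algebraMap_self_apply]

theorem map_map {F A B C : Type*} [CommRing F] [CommRing A] [CommRing B] [CommRing C] [Algebra F A]
    [Algebra F B] [Algebra F C] [Algebra A B] [Algebra A C] [Algebra B C] [IsScalarTower F A B]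
    [IsScalarTower F A C] [IsScalarTower F B C] [IsScalarTower A B C] (ξ : Ω[A⁄F]) :
    map F F B C (map F F A B ξ) = map F F A C ξ := by
  rw [← formMap_toAlgHom, ← formMap_map (IsScalarTower.toAlgHom A B C)]
  rfl

theorem map_injective (F E K : Type*) [CommRing F] [Field E] [Field K] [Algebra F E]
    [Algebra F K] [Algebra E K] [IsScalarTower F E K] [Algebra.FormallySmooth E K] :
    Function.Injective (map F F E K) := by
  have hmap : Function.Injective (mapBaseChange F E K) := by
    rw [injective_iff_map_eq_zero]
    intro x hx
    obtain ⟨y, rfl⟩ := (Algebra.H1Cotangent.exact_δ_mapBaseChange F E K x).1 hx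
    rw [Subsingleton.elim y 0, map_zero]
  intro ξ η h
  apply Module.FaithfullyFlat.tensorProduct_mk_injective (A := E) (B := K) _
  apply hmap
  simpa using h

theorem formallySmooth_of_charZero (E K : Type*) [Field E] [Field K] [Algebra E K] [CharZero E] :
    Algebra.FormallySmooth E K := by
  obtain ⟨s, hs⟩ := exists_isTranscendenceBasis E K
  have := hs.isAlgebraic_field
  exact .of_algebraicIndependent_of_isSeparable hs.1

theorem isAlgebraic_of_D_eq_zero {F K : Type*} [Field F] [Field K] [Algebra F K] [CharZero F]
    {f : K} (hf : D F K f = 0) : IsAlgebraic F f := by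
  have hD : ∀ e ∈ F⟮f⟯, D F K e = 0 := fun e he => by
    induction he using IntermediateField.adjoin_induction with
    | mem x hx => rw [Set.mem_singleton_iff.1 hx, hf]
    | algebraMap c => exact Derivation.map_algebraMap _ c
    | add x y _ _ hx hy => rw [map_add, hx, hy, add_zero]
    | inv x _ hx => rw [Derivation.leibniz_inv, hx, smul_zero]
    | mul x y _ _ hx hy => rw [Derivation.leibniz, hx, hy, smul_zero, smul_zero, add_zero]
  have : CharZero F⟮f⟯ := charZero_of_injective_algebraMap (algebraMap F F⟮f⟯).injective
  have := formallySmooth_of_charZero F⟮f⟯ K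
  have hΩ (ξ : Ω[F⟮f⟯⁄F]) : ξ = 0 := by
    induction ξ using kaehlerDifferential_induction with
    | zero => rfl
    | add ξ η hξ hη => rw [hξ, hη, add_zero]
    | smul_D a b =>
      rw [← map_eq_zero_iff _ (map_injective F F⟮f⟯ K), map_smul, map_D]
      exact (congrArg _ (hD b b.2)).trans (smul_zero _)
  have : Algebra.FormallyUnramified F F⟮f⟯ := ⟨⟨fun ξ η => (hΩ ξ).trans (hΩ η).symm⟩⟩
  have : Algebra.EssFiniteType F F⟮f⟯ :=
    IntermediateField.essFiniteType_iff.2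
      (IntermediateField.fg_adjoin_of_finite (Set.finite_singleton f))
  have := Algebra.FormallyUnramified.isSeparable F F⟮f⟯
  have hgen : IsAlgebraic F (IntermediateField.AdjoinSimple.gen F f) :=
    Algebra.IsAlgebraic.isAlgebraic _
  exact hgen.algebraMap

theorem mem_range_algebraMap_of_isAlgebraic {F K : Type*} [Field F] [IsAlgClosed F] [Field K]
    [Algebra F K] {f : K} (hf : IsAlgebraic F f) : f ∈ Set.range (algebraMap F K) :=
  minpoly.mem_range_of_degree_eq_one F f
    (IsAlgClosed.degree_eq_one_of_irreducible F (minpoly.irreducible hf.isIntegral))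

theorem D_eq_zero_iff {F K : Type*} [Field F] [IsAlgClosed F] [CharZero F] [Field K]
    [Algebra F K] {f : K} : D F K f = 0 ↔ f ∈ Set.range (algebraMap F K) := by
  refine ⟨fun hf => mem_range_algebraMap_of_isAlgebraic (isAlgebraic_of_D_eq_zero hf), ?_⟩
  rintro ⟨c, rfl⟩
  exact Derivation.map_algebraMap _ c

end Forms

section Wedge

variable {F M : Type*} [Field F] [Field M] [Algebra F M]

theorem wedgeEqZero_iff_exists_smul {α β : Ω[M⁄F]} (hβ : β ≠ 0) :
    WedgeEqZero F α β ↔ ∃ c : M, α = c • β := by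
  constructor
  · intro h
    obtain ⟨φ, hφ⟩ := Module.Projective.exists_dual_eq_one M hβ
    have hcontract := congrArg (CliffordAlgebra.contractLeft φ) h
    rw [ExteriorAlgebra.ι, CliffordAlgebra.contractLeft_ι_mul, CliffordAlgebra.contractLeft_ι, hφ,
      map_one, mul_one, map_zero, sub_eq_zero, ← map_smul] at hcontract
    exact ⟨φ α, ((ExteriorAlgebra.ι_inj M _ _).1 hcontract).symm⟩
  · rintro ⟨c, rfl⟩
    rw [WedgeEqZero, map_smul, smul_mul_assoc, ExteriorAlgebra.ι_sq_zero, smul_zero]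

end Wedge

section Elementary

variable (F : Type*) {M M' : Type*} [Field F] [Field M] [Field M'] [Algebra F M] [Algebra F M']

/-- The logarithmic differential `u ↦ du / u`, a homomorphism from `Mˣ` to the one-forms. -/
def dlog : Additive Mˣ →+ Ω[M⁄F] where
  toFun u := (u.toMul : M)⁻¹ • D F M (u.toMul : M)
  map_zero' := by simp
  map_add' u v := by
    simp only [toMul_add, Units.val_mul, Derivation.leibniz, smul_add, smul_smul]
    rw [add_comm]
    congr 2 <;> field_simp

theorem dlog_ofMul (u : Mˣ) : dlog F (Additive.ofMul u) = (u : M)⁻¹ • D F M (u : M) := rfl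

theorem formMap_dlog (φ : M →ₐ[F] M') (u : Mˣ) :
    formMap F φ (dlog F (Additive.ofMul u)) =
      dlog F (Additive.ofMul (Units.map (φ : M →* M') u)) := by
  simp only [dlog_ofMul, formMap_smul, formMap_D, map_inv₀, Units.coe_map, MonoidHom.coe_coe]

theorem map_dlog [Algebra M M'] [IsScalarTower F M M'] (u : Mˣ) :
    map F F M M' (dlog F (Additive.ofMul u)) =
      dlog F (Additive.ofMul (Units.map (algebraMap M M' : M →* M') u)) := by
  rw [← formMap_toAlgHom, formMap_dlog]
  rfl

variable {F}

/-- The forms `dv + ∑ cᵢ duᵢ / uᵢ` with `v ∈ S`, `uᵢ ∈ U` and constants `cᵢ`. With `S = ⊤` and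
`U = ⊤` these are all elementary forms over `M`. -/
def elemForms (S : Submodule F M) (U : Subgroup Mˣ) : Submodule F Ω[M⁄F] :=
  S.map (D F M : M →ₗ[F] Ω[M⁄F]) ⊔ Submodule.span F ((fun u => dlog F (Additive.ofMul u)) '' U)

theorem D_mem_elemForms {S : Submodule F M} (U : Subgroup Mˣ) {v : M} (hv : v ∈ S) :
    D F M v ∈ elemForms S U :=
  Submodule.mem_sup_left ⟨v, hv, rfl⟩

theorem dlog_mem_elemForms (S : Submodule F M) {U : Subgroup Mˣ} {u : Mˣ} (hu : u ∈ U) :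
    dlog F (Additive.ofMul u) ∈ elemForms S U :=
  Submodule.mem_sup_right (Submodule.subset_span ⟨u, hu, rfl⟩)

theorem elemForms_le {S : Submodule F M} {U : Subgroup Mˣ} {N : Submodule F Ω[M⁄F]}
    (hS : ∀ v ∈ S, D F M v ∈ N) (hU : ∀ u ∈ U, dlog F (Additive.ofMul u) ∈ N) :
    elemForms S U ≤ N := by
  refine sup_le ?_ (Submodule.span_le.2 ?_)
  · rintro _ ⟨v, hv, rfl⟩
    exact hS v hv
  · rintro _ ⟨u, hu, rfl⟩
    exact hU u hu

theorem elemForms_mono {S T : Submodule F M} {U V : Subgroup Mˣ} (hST : S ≤ T) (hUV : U ≤ V) :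
    elemForms S U ≤ elemForms T V :=
  elemForms_le (fun _ hv => D_mem_elemForms V (hST hv)) fun _ hu => dlog_mem_elemForms T (hUV hu)

theorem mem_elemForms_iff {S : Submodule F M} {U : Subgroup Mˣ} {γ : Ω[M⁄F]} :
    γ ∈ elemForms S U ↔ ∃ (m : ℕ) (v : M) (c : Fin m → F) (u : Fin m → Mˣ),
      v ∈ S ∧ (∀ i, u i ∈ U) ∧ γ = elemForm v c u := by
  constructor
  · intro h
    obtain ⟨_, ⟨v, hv, rfl⟩, η, hη, rfl⟩ := Submodule.mem_sup.1 h
    obtain ⟨m, c, g, rfl⟩ := Submodule.mem_span_set'.1 hη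
    choose u hu hg using fun i => (g i).2
    refine ⟨m, v, c, u, hv, hu, ?_⟩
    simp only [elemForm, ← hg, dlog_ofMul]
    rfl
  · rintro ⟨m, v, c, u, hv, hu, rfl⟩
    exact add_mem (D_mem_elemForms U hv) <| sum_mem fun i _ =>
      Submodule.smul_mem _ _ (dlog_mem_elemForms S (hu i))

theorem mem_elemForms_top_iff {γ : Ω[M⁄F]} :
    γ ∈ elemForms (⊤ : Submodule F M) ⊤ ↔
      ∃ (m : ℕ) (v : M) (c : Fin m → F) (u : Fin m → Mˣ), elemForm v c u = γ := by
  simp only [mem_elemForms_iff, Submodule.mem_top, Subgroup.mem_top, implies_true, true_and,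
    eq_comm]

theorem formMap_mem_elemForms {S : Submodule F M} {U : Subgroup Mˣ} {S' : Submodule F M'}
    {U' : Subgroup M'ˣ} (φ : M →ₐ[F] M') (hS : ∀ v ∈ S, φ v ∈ S')
    (hU : ∀ u ∈ U, Units.map (φ : M →* M') u ∈ U') {γ : Ω[M⁄F]} (hγ : γ ∈ elemForms S U) :
    formMap F φ γ ∈ elemForms S' U' := by
  refine elemForms_le (N := (elemForms S' U').comap (formMap F φ)) (fun v hv => ?_)
    (fun u hu => ?_) hγ
  · rw [Submodule.mem_comap, formMap_D]
    exact D_mem_elemForms U' (hS v hv)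
  · rw [Submodule.mem_comap, formMap_dlog]
    exact dlog_mem_elemForms S' (hU u hu)

theorem formMap_mem_elemForms_top (φ : M →ₐ[F] M') {γ : Ω[M⁄F]}
    (hγ : γ ∈ elemForms (⊤ : Submodule F M) ⊤) :
    formMap F φ γ ∈ elemForms (⊤ : Submodule F M') ⊤ :=
  formMap_mem_elemForms φ (fun _ _ => Submodule.mem_top) (fun _ _ => Subgroup.mem_top _) hγ

end Elementary

section Closed

variable (F M : Type*) [Field F] [Field M] [Algebra F M]

/-- The closed one-forms over `M`, by Cartan's formula
`dξ(δ, ε) = δ(ξ(ε)) - ε(ξ(δ)) - ξ([δ, ε])` for vector fields, that is, derivations, `δ` and `ε`. -/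
def closedForms : Submodule F Ω[M⁄F] :=
  ⨅ (δ : Derivation F M M) (ε : Derivation F M M), LinearMap.ker
    ((δ : M →ₗ[F] M) ∘ₗ ε.liftKaehlerDifferential.restrictScalars F -
      (ε : M →ₗ[F] M) ∘ₗ δ.liftKaehlerDifferential.restrictScalars F -
      ⁅δ, ε⁆.liftKaehlerDifferential.restrictScalars F)

variable {F M}

theorem mem_closedForms {ξ : Ω[M⁄F]} : ξ ∈ closedForms F M ↔ ∀ δ ε : Derivation F M M,
    δ (ε.liftKaehlerDifferential ξ) - ε (δ.liftKaehlerDifferential ξ) =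
      ⁅δ, ε⁆.liftKaehlerDifferential ξ := by
  simp only [closedForms, Submodule.mem_iInf, LinearMap.mem_ker, LinearMap.sub_apply,
    LinearMap.comp_apply, LinearMap.restrictScalars_apply, Derivation.coeFn_coe, sub_eq_zero]

theorem elemForms_le_closedForms (S : Submodule F M) (U : Subgroup Mˣ) :
    elemForms S U ≤ closedForms F M := by
  refine elemForms_le (fun v _ => ?_) fun u _ => ?_
  · simp only [mem_closedForms, Derivation.liftKaehlerDifferential_comp_D,
      Derivation.commutator_apply, implies_true]
  · refine mem_closedForms.2 fun δ ε => ?_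
    simp only [dlog_ofMul, map_smul, Derivation.liftKaehlerDifferential_comp_D,
      Derivation.commutator_apply, smul_eq_mul, Derivation.leibniz, Derivation.leibniz_inv]
    ring

theorem exists_D_eq_smul_of_mem_closedForms {ω : Ω[M⁄F]} (hω : ω ≠ 0) {f h : M} (hh : h ≠ 0)
    (hclosed : h • ω ∈ closedForms F M) (hfclosed : (f * h) • ω ∈ closedForms F M) :
    ∃ c : M, D F M f = c • ω := by
  have hsymm (δ ε : Derivation F M M) :
      δ f * ε.liftKaehlerDifferential ω = ε f * δ.liftKaehlerDifferential ω := by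
    have hδε := mem_closedForms.1 hclosed δ ε
    have hfδε := mem_closedForms.1 hfclosed δ ε
    simp only [map_smul, smul_eq_mul, mul_assoc f, Derivation.leibniz _ f] at hδε hfδε
    apply mul_left_cancel₀ hh
    linear_combination hfδε - f * hδε
  have hsurj := (linearMapEquivDerivation F M (M := M)).symm.surjective
  obtain ⟨φ, hφ⟩ := Module.Projective.exists_dual_eq_one M hω
  obtain ⟨ε, rfl : ε.liftKaehlerDifferential = φ⟩ := hsurj φ
  refine ⟨ε f, sub_eq_zero.1 <| (Module.forall_dual_apply_eq_zero_iff M _).1 fun ψ => ?_⟩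
  obtain ⟨δ, rfl : δ.liftKaehlerDifferential = ψ⟩ := hsurj ψ
  rw [map_sub, map_smul, δ.liftKaehlerDifferential_comp_D, smul_eq_mul, ← hsymm, hφ, mul_one,
    sub_self]

end Closed

section FirstIntegrals

theorem derivation_coeff_minpoly_eq_zero {F K M : Type*} [CommRing F] [Field K] [Field M]
    [Algebra F K] [Algebra F M] [Algebra K M] (δ : Derivation F K K) (ε : Derivation F M M)
    (hδε : ∀ k, algebraMap K M (δ k) = ε (algebraMap K M k)) {f : M} (hf : IsIntegral K f)
    (hεf : ε f = 0) (i : ℕ) : δ ((minpoly K f).coeff i) = 0 := by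
  -- Applying `δ` to the coefficients of the monic `p` lowers the degree, and still gives a
  -- polynomial with root `f`.
  set p := minpoly K f with hp
  let q : Polynomial K := PolynomialModule.equivPolynomial (δ.mapCoeffs p)
  have hq (i : ℕ) : q.coeff i = δ (p.coeff i) := rfl
  have hqf : Polynomial.aeval f q = 0 := by
    have h := δ.apply_aeval_eq' ε (Algebra.linearMap K M) hδε f p
    rw [hp, minpoly.aeval, map_zero, hεf, smul_zero, add_zero] at h
    exact (PolynomialModule.aeval_equivPolynomial _ _).trans h.symm
  have hdeg : q.degree < p.degree := by
    rw [Polynomial.degree_eq_natDegree (minpoly.ne_zero hf), Polynomial.degree_lt_iff_coeff_zero]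
    intro m hm
    rw [hq]
    rcases hm.eq_or_lt with rfl | hm
    · rw [Polynomial.coeff_natDegree, (minpoly.monic hf).leadingCoeff, Derivation.map_one_eq_zero]
    · rw [Polynomial.coeff_eq_zero_of_natDegree_lt hm, map_zero]
  have hq_zero : q = 0 := by
    by_contra hne
    exact (minpoly.degree_le_of_ne_zero K f hne hqf).not_gt hdeg
  rw [← hq, hq_zero, Polynomial.coeff_zero]

variable {F K M : Type*} [Field F] [Field K] [Field M] [Algebra F K] [Algebra F M] [Algebra K M]
  [IsScalarTower F K M]

theorem isIntegral_of_coeff_minpoly_mem_range {f : M} (hf : IsIntegral K f)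
    (hcoeff : ∀ i, (minpoly K f).coeff i ∈ Set.range (algebraMap F K)) : IsIntegral F f := by
  obtain ⟨r, hr⟩ := (Polynomial.lifts_iff_coeff_lifts (minpoly K f)).2 hcoeff
  rw [Polynomial.coe_mapRingHom] at hr
  refine ⟨r, ?_, ?_⟩
  · exact Polynomial.monic_of_injective (algebraMap F K).injective (hr ▸ minpoly.monic hf)
  · rw [← Polynomial.aeval_def, ← Polynomial.aeval_map_algebraMap K, hr, minpoly.aeval]

variable [Algebra.IsSeparable K M]

theorem exists_dual_map_eq (φ : Module.Dual K Ω[K⁄F]) :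
    ∃ ψ : Module.Dual M Ω[M⁄F], ∀ ω, ψ (map F F K M ω) = algebraMap K M (φ ω) := by
  have := Algebra.FormallyEtale.of_isSeparable K M
  have hbase := isBaseChange_of_formallyEtale F K M
  exact ⟨hbase.lift (Algebra.linearMap K M ∘ₗ φ), fun ω => hbase.lift_eq _ ω⟩

theorem D_coeff_minpoly_mem_span {ω : Ω[K⁄F]} {f c : M} (hf : D F M f = c • map F F K M ω)
    (i : ℕ) : D F K ((minpoly K f).coeff i) ∈ Submodule.span K {ω} := by
  -- A functional that vanishes at `ω` extends to a derivation of `M` that kills `f`.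
  by_contra hi
  obtain ⟨φ, hφi, hφω⟩ := Submodule.exists_le_ker_of_notMem hi
  rw [Submodule.span_singleton_le_iff_mem, LinearMap.mem_ker] at hφω
  obtain ⟨ψ, hψ⟩ := exists_dual_map_eq (M := M) φ
  refine hφi (derivation_coeff_minpoly_eq_zero (φ.compDer (D F K)) (ψ.compDer (D F M)) (fun k => ?_)
    (Algebra.IsIntegral.isIntegral f) ?_ i)
  · exact (hψ _).symm.trans (congrArg ψ (map_D F F K M k))
  · change ψ (D F M f) = 0
    rw [hf, map_smul, hψ, hφω, map_zero, smul_zero]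

end FirstIntegrals

section Trace

variable (F L M : Type*) [Field F] [Field L] [Field M] [Algebra F L] [Algebra F M] [Algebra L M]

/-- The forms `dv + ∑ cᵢ duᵢ / uᵢ` over `M` with `v` of trace zero, all `uᵢ` of norm one (trace and
norm of `M / L`), and constants `cᵢ`. -/
def traceNormForms [IsScalarTower F L M] : Submodule F Ω[M⁄F] :=
  elemForms ((LinearMap.ker (Algebra.trace L M)).restrictScalars F)
    (Units.map (Algebra.norm L : M →* L)).ker

variable [IsScalarTower F L M]

variable {F L M} in
theorem traceNormForms_le_elemForms :
    traceNormForms F L M ≤ elemForms (⊤ : Submodule F M) ⊤ :=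
  elemForms_mono le_top le_top

variable [FiniteDimensional L M]

/-- The trace `ξ ↦ ∑ σ, σ(ξ)` of one-forms along a finite Galois extension `M / L`, as a map with
values in the forms over `M`. -/
def formTrace : Ω[M⁄F] →ₗ[F] Ω[M⁄F] :=
  ∑ σ : M ≃ₐ[L] M, formMap F ((σ : M →ₐ[L] M).restrictScalars F)

variable {F L M}

theorem formTrace_apply (ξ : Ω[M⁄F]) : formTrace F L M ξ =
    ∑ σ : M ≃ₐ[L] M, formMap F ((σ : M →ₐ[L] M).restrictScalars F) ξ :=
  LinearMap.sum_apply _ _ _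

variable [IsGalois L M]

theorem formTrace_smul_map (a : M) (ω : Ω[L⁄F]) :
    formTrace F L M (a • map F F L M ω) = map F F L M (Algebra.trace L M a • ω) := by
  simp only [formTrace_apply, formMap_smul, formMap_map, ← Finset.sum_smul, map_smul]
  rw [← algebraMap_smul M (Algebra.trace L M a), trace_eq_sum_automorphisms]
  rfl

theorem formTrace_map (ω : Ω[L⁄F]) :
    formTrace F L M (map F F L M ω) = Module.finrank L M • map F F L M ω := by
  rw [← one_smul M (map F F L M ω), formTrace_smul_map, ← map_one (algebraMap L M),
    Algebra.trace_algebraMap, smul_assoc, one_smul, map_nsmul, map_one, one_smul]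

theorem exists_map_eq_formTrace (ξ : Ω[M⁄F]) :
    ∃ ω : Ω[L⁄F], map F F L M ω = formTrace F L M ξ := by
  have := Algebra.FormallyEtale.of_isSeparable L M
  have hbase : IsTensorProduct _ := isBaseChange_of_formallyEtale F L M
  induction ξ using hbase.inductionOn with
  | zero => exact ⟨0, by simp only [map_zero]⟩
  | tmul a ω => exact ⟨_, (formTrace_smul_map a ω).symm⟩
  | add ξ η hξ hη =>
    obtain ⟨ω, hω⟩ := hξ
    obtain ⟨ω', hω'⟩ := hη
    exact ⟨ω + ω', by rw [map_add, map_add, hω, hω']⟩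

theorem formTrace_D (v : M) :
    formTrace F L M (D F M v) = map F F L M (D F L (Algebra.trace L M v)) := by
  simp only [formTrace_apply, formMap_D, ← map_sum, map_D, trace_eq_sum_automorphisms]
  rfl

theorem prod_unitsMap_eq_norm {L M : Type*} [Field L] [Field M] [Algebra L M]
    [FiniteDimensional L M] [IsGalois L M] (u : Mˣ) :
    ∏ σ : M ≃ₐ[L] M, Units.map (σ : M →* M) u =
      Units.map (algebraMap L M : L →* M) (Units.map (Algebra.norm L : M →* L) u) := by
  ext
  simp only [Units.coe_prod, Units.coe_map, MonoidHom.coe_coe, Algebra.norm_eq_prod_automorphisms]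

theorem formTrace_dlog (u : Mˣ) : formTrace F L M (dlog F (Additive.ofMul u)) =
    map F F L M (dlog F (Additive.ofMul (Units.map (Algebra.norm L : M →* L) u))) := by
  rw [map_dlog, ← prod_unitsMap_eq_norm, ofMul_prod, map_sum, formTrace_apply]
  exact Finset.sum_congr rfl fun σ _ => formMap_dlog F _ u

theorem exists_map_eq_formTrace_of_mem_elemForms {γ : Ω[M⁄F]}
    (hγ : γ ∈ elemForms (⊤ : Submodule F M) ⊤) :
    ∃ δ ∈ elemForms (⊤ : Submodule F L) ⊤, map F F L M δ = formTrace F L M γ := by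
  let N := (elemForms (⊤ : Submodule F L) ⊤).map ((map F F L M).restrictScalars F)
  have hN : elemForms (⊤ : Submodule F M) ⊤ ≤ N.comap (formTrace F L M) := by
    refine elemForms_le (fun v _ => ?_) fun u _ => ?_
    · rw [Submodule.mem_comap, formTrace_D]
      exact Submodule.mem_map.2 ⟨_, D_mem_elemForms ⊤ Submodule.mem_top, rfl⟩
    · rw [Submodule.mem_comap, formTrace_dlog]
      exact Submodule.mem_map.2 ⟨_, dlog_mem_elemForms ⊤ (Subgroup.mem_top _), rfl⟩
  exact Submodule.mem_map.1 (Submodule.mem_comap.1 (hN hγ))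

theorem finrank_nsmul_sub_formTrace_mem_traceNormForms {γ : Ω[M⁄F]}
    (hγ : γ ∈ elemForms (⊤ : Submodule F M) ⊤) :
    Module.finrank L M • γ - formTrace F L M γ ∈ traceNormForms F L M := by
  let T : Ω[M⁄F] →ₗ[F] Ω[M⁄F] := Module.finrank L M • LinearMap.id - formTrace F L M
  have hTγ (ξ) : T ξ = Module.finrank L M • ξ - formTrace F L M ξ := rfl
  refine elemForms_le (N := (traceNormForms F L M).comap T) (fun v _ => ?_) (fun u _ => ?_) hγ
  · rw [Submodule.mem_comap, hTγ, formTrace_D, map_D, ← map_nsmul, ← map_sub]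
    refine D_mem_elemForms _ (LinearMap.mem_ker.2 ?_)
    rw [map_sub, map_nsmul, Algebra.trace_algebraMap, sub_self]
  · rw [Submodule.mem_comap, hTγ, formTrace_dlog, map_dlog, ← map_nsmul, ← map_sub, ← ofMul_pow,
      ← ofMul_div]
    refine dlog_mem_elemForms _ (MonoidHom.mem_ker.2 ?_)
    ext
    simp only [map_div, map_pow, Units.val_div_eq_div_val, Units.val_pow_eq_pow_val, Units.coe_map,
      MonoidHom.coe_coe, Algebra.norm_algebraMap, Units.val_one]
    exact div_self (pow_ne_zero _ (Algebra.norm_ne_zero_iff.2 u.ne_zero))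

theorem mem_elemForms_of_map_mem [CharZero F] {η : Ω[L⁄F]}
    (hη : map F F L M η ∈ elemForms (⊤ : Submodule F M) ⊤) :
    η ∈ elemForms (⊤ : Submodule F L) ⊤ := by
  have := Algebra.FormallyEtale.of_isSeparable L M
  obtain ⟨δ, hδ, h⟩ := exists_map_eq_formTrace_of_mem_elemForms (L := L) hη
  rw [formTrace_map, ← map_nsmul] at h
  rw [map_injective F L M h, ← Nat.cast_smul_eq_nsmul F] at hδ
  exact (Submodule.smul_mem_iff _ (Nat.cast_ne_zero.2 Module.finrank_pos.ne')).1 hδ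

theorem smul_map_mem_elemForms_of_algebraMap_smul_map_mem [CharZero F] {K : Type*} [Field K]
    [Algebra F K] [Algebra K L] [Algebra K M] [IsScalarTower F K L] [IsScalarTower F K M]
    [IsScalarTower K L M] {h : L} {ω : Ω[K⁄F]}
    (hω : algebraMap L M h • map F F K M ω ∈ elemForms (⊤ : Submodule F M) ⊤) :
    h • map F F K L ω ∈ elemForms (⊤ : Submodule F L) ⊤ := by
  refine mem_elemForms_of_map_mem (M := M) ?_
  rwa [map_smul, map_map, ← algebraMap_smul M h]

end Trace

section Relations

variable {F : Type u} {K : Type v} [Field F] [Field K] [Algebra F K]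

/-- The form `ω` admits a first integral in `K` that is not a constant. -/
def HasFirstIntegral (ω : Ω[K⁄F]) : Prop :=
  ∃ f : K, f ∉ Set.range (algebraMap F K) ∧ WedgeEqZero F (D F K f) ω

/-- The form `ω` over `K` satisfies an elementary relation over the extension field `M`. -/
def HasElementaryRelationOver (M : Type w) [Field M] [Algebra F M] [Algebra K M]
    [IsScalarTower F K M] (ω : Ω[K⁄F]) : Prop :=
  ∃ γ ∈ elemForms (⊤ : Submodule F M) ⊤, γ ≠ 0 ∧ WedgeEqZero F γ (map F F K M ω)

/-- The form `ω` over `K` satisfies an elementary relation over some finite extension of `K`, but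
none over `K` itself. This is `ElemInt.IsExceptional` for an arbitrary field `K`. -/
def IsExceptionalForm (ω : Ω[K⁄F]) : Prop :=
  (∃ (M : Type v) (_ : Field M) (_ : Algebra F M) (_ : Algebra K M) (_ : IsScalarTower F K M),
      FiniteDimensional K M ∧ HasElementaryRelationOver M ω) ∧
    ¬ HasElementaryRelationOver K ω

variable {M : Type w} [Field M] [Algebra F M] [Algebra K M] [IsScalarTower F K M]

theorem hasElementaryRelationOver_iff [Algebra.FormallySmooth K M] {ω : Ω[K⁄F]} (hω : ω ≠ 0) :
    HasElementaryRelationOver M ω ↔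
      ∃ h : M, h ≠ 0 ∧ h • map F F K M ω ∈ elemForms (⊤ : Submodule F M) ⊤ := by
  have hωM : map F F K M ω ≠ 0 :=
    (map_ne_zero_iff _ (map_injective F K M)).2 hω
  constructor
  · rintro ⟨γ, hγ, hγ0, hwedge⟩
    obtain ⟨h, rfl⟩ := (wedgeEqZero_iff_exists_smul hωM).1 hwedge
    exact ⟨h, left_ne_zero_of_smul hγ0, hγ⟩
  · rintro ⟨h, hh, hhω⟩
    exact ⟨_, hhω, smul_ne_zero hh hωM, (wedgeEqZero_iff_exists_smul hωM).2 ⟨h, rfl⟩⟩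

section IsAlgClosed

variable [IsAlgClosed F] {ω : Ω[K⁄F]}

theorem mem_range_of_D_eq_smul [Algebra.IsSeparable K M] (hω : ω ≠ 0)
    (hint : ¬ HasFirstIntegral ω) {f c : M} (hf : D F M f = c • map F F K M ω) :
    f ∈ Set.range (algebraMap F M) := by
  refine mem_range_algebraMap_of_isAlgebraic (IsIntegral.isAlgebraic ?_)
  have hfK : IsIntegral K f := Algebra.IsIntegral.isIntegral f
  refine isIntegral_of_coeff_minpoly_mem_range hfK fun i => ?_
  by_contra hi
  obtain ⟨b, hb⟩ := Submodule.mem_span_singleton.1 (D_coeff_minpoly_mem_span hf i)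
  exact hint ⟨_, hi, (wedgeEqZero_iff_exists_smul hω).2 ⟨b, hb.symm⟩⟩

theorem mem_range_of_not_hasFirstIntegral_zero (hint : ¬ HasFirstIntegral (0 : Ω[K⁄F])) {f : M}
    (hf : IsIntegral K f) : f ∈ Set.range (algebraMap F M) := by
  refine mem_range_algebraMap_of_isAlgebraic (IsIntegral.isAlgebraic ?_)
  refine isIntegral_of_coeff_minpoly_mem_range hf fun i => ?_
  by_contra hi
  exact hint ⟨_, hi, by rw [WedgeEqZero, map_zero, mul_zero]⟩

theorem exists_eq_smul_of_smul_mem_elemForms [Algebra.IsSeparable K M] (hω : ω ≠ 0)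
    (hint : ¬ HasFirstIntegral ω) {h g : M} (hh : h ≠ 0)
    (hhω : h • map F F K M ω ∈ elemForms (⊤ : Submodule F M) ⊤)
    (hgω : g • map F F K M ω ∈ elemForms (⊤ : Submodule F M) ⊤) : ∃ c : F, g = c • h := by
  have := Algebra.FormallyEtale.of_isSeparable K M
  have hclosed := elemForms_le_closedForms (F := F) (M := M) ⊤ ⊤
  obtain ⟨c, hc⟩ := exists_D_eq_smul_of_mem_closedForms (f := g / h)
    ((map_ne_zero_iff _ (map_injective F K M)).2 hω) hh (hclosed hhω)
    (by rw [div_mul_cancel₀ _ hh]; exact hclosed hgω)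
  obtain ⟨a, ha⟩ := mem_range_of_D_eq_smul hω hint hc
  exact ⟨a, by rw [Algebra.smul_def, ha, div_mul_cancel₀ _ hh]⟩

variable [CharZero F]

theorem not_hasFirstIntegral_of_not_hasElementaryRelationOver
    (hω : ¬ HasElementaryRelationOver K ω) : ¬ HasFirstIntegral ω := by
  rintro ⟨f, hf, hwedge⟩
  exact hω ⟨_, D_mem_elemForms ⊤ Submodule.mem_top, mt D_eq_zero_iff.1 hf, by rwa [map_self]⟩

theorem IsExceptionalForm.not_hasFirstIntegral (hω : IsExceptionalForm ω) :
    ¬ HasFirstIntegral ω :=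
  not_hasFirstIntegral_of_not_hasElementaryRelationOver hω.2

theorem IsExceptionalForm.ne_zero (hω : IsExceptionalForm ω) : ω ≠ 0 := by
  rintro rfl
  obtain ⟨M, _, _, _, _, _, γ, hγ, hγ0, -⟩ := hω.1
  have hD (f : M) : D F M f = 0 := D_eq_zero_iff.2 <|
    mem_range_of_not_hasFirstIntegral_zero hω.not_hasFirstIntegral (Algebra.IsIntegral.isIntegral f)
  have hzero : elemForms (⊤ : Submodule F M) ⊤ ≤ ⊥ := by
    refine elemForms_le (fun v _ => hD v) fun u _ => ?_
    rw [Submodule.mem_bot, dlog_ofMul, hD, smul_zero]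
  exact hγ0 (hzero hγ)

end IsAlgClosed

end Relations

section Kummer

variable {F : Type u} {K : Type v} {L : Type w} [Field F] [Field K] [Field L] [Algebra F L]
  [Algebra K L]

/-- `L = K(ℓ)` is a cyclic Galois extension of `K` of degree `n > 1`, its Galois group is
generated by `τ`, and `τ(ℓ) = ζ ℓ` with a primitive `n`-th root of unity `ζ ∈ F`. This is
`ElemInt.IsCyclicSetting` for an arbitrary field `K`. -/
structure IsKummerSetting (n : ℕ) (ζ : F) (τ : L ≃ₐ[K] L) (ℓ : L) : Prop where
  one_lt : 1 < n
  finrank_eq : Module.finrank K L = n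
  isGalois : IsGalois K L
  generates : ∀ σ : L ≃ₐ[K] L, σ ∈ Subgroup.zpowers τ
  isPrimitiveRoot : IsPrimitiveRoot ζ n
  adjoin_eq_top : K⟮ℓ⟯ = ⊤
  map_eq : τ ℓ = ζ • ℓ

namespace IsKummerSetting

variable {n : ℕ} {ζ : F} {τ : L ≃ₐ[K] L} {ℓ : L} (h : IsKummerSetting n ζ τ ℓ)

include h

theorem finiteDimensional : FiniteDimensional K L :=
  Module.finite_of_finrank_pos (h.finrank_eq ▸ h.one_lt.pos)

theorem orderOf_eq : orderOf τ = n := by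
  have := h.finiteDimensional
  have := h.isGalois
  rw [orderOf_eq_card_of_forall_mem_zpowers h.generates, IsGalois.card_aut_eq_finrank,
    h.finrank_eq]

theorem sum_algEquiv_eq_sum_range [FiniteDimensional K L] {A : Type*} [AddCommMonoid A]
    (f : (L ≃ₐ[K] L) → A) : ∑ σ, f σ = ∑ j ∈ Finset.range n, f (τ ^ j) := by
  classical
  have hinj : Set.InjOn (τ ^ ·) (Finset.range (orderOf τ) : Set ℕ) := by
    rw [Finset.coe_range]
    exact pow_injOn_Iio_orderOf
  rw [← h.orderOf_eq, ← IsCyclic.image_range_orderOf h.generates, Finset.sum_image hinj]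

theorem gen_notMem_range : ℓ ∉ Set.range (algebraMap K L) := by
  intro hℓ
  have htop := h.adjoin_eq_top
  rw [IntermediateField.adjoin_simple_eq_bot_iff.2 (IntermediateField.mem_bot.2 hℓ)] at htop
  refine h.one_lt.ne ?_
  rw [← h.finrank_eq, ← IntermediateField.finrank_top', ← htop, IntermediateField.finrank_bot]

theorem natCast_ne_zero : (n : F) ≠ 0 :=
  have : NeZero n := ⟨h.one_lt.ne_bot⟩
  h.isPrimitiveRoot.neZero'.out

theorem gen_ne_zero : ℓ ≠ 0 := by
  rintro rfl
  exact h.gen_notMem_range ⟨0, map_zero _⟩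

end IsKummerSetting

variable [Algebra F K] [IsScalarTower F K L]

/-- The projection `ξ ↦ (1/n) ∑_{j < n} ζ⁻ʲ τʲ(ξ)` of one-forms over `L` to the `ζ`-eigenforms of
`τ`. This is `ElemInt.Pr` for an arbitrary field `K`. -/
def kummerProj (n : ℕ) (ζ : F) (τ : L ≃ₐ[K] L) (ξ : Ω[L⁄F]) : Ω[L⁄F] :=
  (n : F)⁻¹ • ∑ j ∈ Finset.range n,
    (ζ⁻¹) ^ j • formMap F (((τ ^ j : L ≃ₐ[K] L) : L →ₐ[K] L).restrictScalars F) ξ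

theorem formMap_mem_traceNormForms (σ : L ≃ₐ[K] L) {γ : Ω[L⁄F]} (hγ : γ ∈ traceNormForms F K L) :
    formMap F ((σ : L →ₐ[K] L).restrictScalars F) γ ∈ traceNormForms F K L := by
  refine formMap_mem_elemForms _ (fun v hv => ?_) (fun u hu => ?_) hγ
  · exact (Algebra.trace_eq_of_algEquiv σ v).trans hv
  · rw [MonoidHom.mem_ker, Units.ext_iff] at hu ⊢
    exact (Algebra.norm_eq_of_algEquiv σ (u : L)).trans hu

theorem kummerProj_mem_traceNormForms (n : ℕ) (ζ : F) (τ : L ≃ₐ[K] L) {γ : Ω[L⁄F]}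
    (hγ : γ ∈ traceNormForms F K L) : kummerProj n ζ τ γ ∈ traceNormForms F K L :=
  Submodule.smul_mem _ _ <| sum_mem fun j _ =>
    Submodule.smul_mem _ _ (formMap_mem_traceNormForms (τ ^ j) hγ)

namespace IsKummerSetting

variable {n : ℕ} {ζ : F} {τ : L ≃ₐ[K] L} {ℓ : L} (h : IsKummerSetting n ζ τ ℓ)

include h

theorem pow_apply_gen (j : ℕ) : (τ ^ j) ℓ = ζ ^ j • ℓ := by
  induction j with
  | zero => rw [pow_zero, pow_zero, one_smul, AlgEquiv.one_apply]
  | succ j ih =>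
    rw [pow_succ', AlgEquiv.mul_apply, ih, LinearMapClass.map_smul_of_tower, h.map_eq, smul_smul,
      pow_succ]

theorem trace_gen : Algebra.trace K L ℓ = 0 := by
  have := h.finiteDimensional
  have := h.isGalois
  apply (algebraMap K L).injective
  rw [trace_eq_sum_automorphisms, h.sum_algEquiv_eq_sum_range (fun σ => σ ℓ), map_zero]
  simp only [h.pow_apply_gen, ← Finset.sum_smul, h.isPrimitiveRoot.geom_sum_eq_zero h.one_lt,
    zero_smul]

theorem kummerProj_eq_smul_formTrace [FiniteDimensional K L] (ξ : Ω[L⁄F]) :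
    kummerProj n ζ τ ξ = (n : F)⁻¹ • ℓ • formTrace F K L (ℓ⁻¹ • ξ) := by
  rw [kummerProj, formTrace_apply, h.sum_algEquiv_eq_sum_range]
  congr 1
  rw [Finset.smul_sum]
  refine Finset.sum_congr rfl fun j _ => ?_
  have hscalar : ℓ * (τ ^ j) ℓ⁻¹ = algebraMap F L (ζ⁻¹ ^ j) := by
    rw [map_inv₀, h.pow_apply_gen, Algebra.smul_def, mul_inv, mul_comm, inv_mul_cancel_right₀
      h.gen_ne_zero, inv_pow, map_inv₀]
  rw [formMap_smul, smul_smul, ← algebraMap_smul L, ← hscalar]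
  rfl

theorem exists_kummerProj_eq_smul (ξ : Ω[L⁄F]) :
    ∃ ω : Ω[K⁄F], kummerProj n ζ τ ξ = ℓ • map F F K L ω := by
  have := h.finiteDimensional
  have := h.isGalois
  obtain ⟨ω, hω⟩ := exists_map_eq_formTrace (L := K) (ℓ⁻¹ • ξ)
  refine ⟨(n : F)⁻¹ • ω, ?_⟩
  rw [h.kummerProj_eq_smul_formTrace, ← hω, smul_comm, LinearMapClass.map_smul_of_tower]

theorem kummerProj_smul_map (ω : Ω[K⁄F]) :
    kummerProj n ζ τ (ℓ • map F F K L ω) = ℓ • map F F K L ω := by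
  have := h.finiteDimensional
  have := h.isGalois
  rw [h.kummerProj_eq_smul_formTrace, inv_smul_smul₀ h.gen_ne_zero, formTrace_map, h.finrank_eq,
    ← Nat.cast_smul_eq_nsmul F, smul_comm ℓ, inv_smul_smul₀ h.natCast_ne_zero]

theorem smul_map_mem_traceNormForms {ω : Ω[K⁄F]}
    (hω : ℓ • map F F K L ω ∈ elemForms (⊤ : Submodule F L) ⊤) :
    ℓ • map F F K L ω ∈ traceNormForms F K L := by
  have := h.finiteDimensional
  have := h.isGalois
  have hmem := finrank_nsmul_sub_formTrace_mem_traceNormForms (L := K) hω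
  rw [formTrace_smul_map, h.trace_gen, zero_smul, map_zero, sub_zero, h.finrank_eq,
    ← Nat.cast_smul_eq_nsmul F] at hmem
  exact (Submodule.smul_mem_iff _ h.natCast_ne_zero).1 hmem

end IsKummerSetting

theorem IsKummerSetting.isExceptionalForm [IsAlgClosed F] {L : Type v} [Field L]
    [Algebra F L] [Algebra K L] [IsScalarTower F K L] {n : ℕ} {ζ : F} {τ : L ≃ₐ[K] L} {ℓ : L}
    (h : IsKummerSetting n ζ τ ℓ) {ω : Ω[K⁄F]} (hint : ¬ HasFirstIntegral ω)
    (hℓω : ℓ • map F F K L ω ∈ elemForms (⊤ : Submodule F L) ⊤) : IsExceptionalForm ω := by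
  have hfin := h.finiteDimensional
  have := h.isGalois
  have := Algebra.FormallyEtale.of_isSeparable K L
  have hrange (c : F) (k : K) : ℓ ≠ c • algebraMap K L k := fun hc =>
    h.gen_notMem_range ⟨c • k, by rw [algebraMap.smul, hc]⟩
  have hω : ω ≠ 0 := by
    rintro rfl
    obtain ⟨c, hc⟩ := mem_range_of_not_hasFirstIntegral_zero hint (Algebra.IsIntegral.isIntegral ℓ)
    exact hrange c 1 (by rw [map_one, ← hc, Algebra.algebraMap_eq_smul_one])
  refine ⟨⟨L, _, _, _, _, hfin, (hasElementaryRelationOver_iff hω).2 ⟨ℓ, h.gen_ne_zero, hℓω⟩⟩, ?_⟩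
  rw [hasElementaryRelationOver_iff hω]
  rintro ⟨k, hk, hkω⟩
  have hkωL := formMap_mem_elemForms_top (IsScalarTower.toAlgHom F K L) hkω
  rw [map_self, formMap_smul, formMap_toAlgHom] at hkωL
  obtain ⟨c, hc⟩ := exists_eq_smul_of_smul_mem_elemForms hω hint
    ((map_ne_zero (algebraMap K L)).2 hk) hkωL hℓω
  exact hrange c k hc

end Kummer

section KummerTheory

variable {K : Type*} [Field K]

theorem isGalois_adjoin_simple {M : Type*} [Field M] [Algebra K M] [IsGalois K M] {h : M}
    (hσ : ∀ σ : M ≃ₐ[K] M, σ h ∈ K⟮h⟯) : IsGalois K K⟮h⟯ := by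
  have : Normal K K⟮h⟯ := by
    refine IntermediateField.normal_iff_forall_map_le'.2 fun σ => ?_
    rw [IntermediateField.adjoin_map, IntermediateField.adjoin_le_iff, Set.image_singleton,
      Set.singleton_subset_iff]
    exact hσ σ
  exact {}

theorem adjoin_gen_eq_top {M : Type*} [Field M] [Algebra K M] (h : M) :
    K⟮IntermediateField.AdjoinSimple.gen K h⟯ = ⊤ := by
  apply IntermediateField.lift_injective K⟮h⟯
  rw [IntermediateField.lift_adjoin_simple, IntermediateField.lift_top,
    IntermediateField.AdjoinSimple.coe_gen]

theorem algEquiv_ext_of_adjoin_eq_top {L : Type*} [Field L] [Algebra K L] {ℓ : L}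
    (htop : K⟮ℓ⟯ = ⊤) {σ τ : L ≃ₐ[K] L} (hστ : σ ℓ = τ ℓ) : σ = τ := by
  have hcomp := IntermediateField.algHom_ext_of_eq_adjoin K htop.symm
    (φ₁ := (σ : L →ₐ[K] L).comp (⊤ : IntermediateField K L).val)
    (φ₂ := (τ : L →ₐ[K] L).comp (⊤ : IntermediateField K L).val)
    fun x hx => by obtain rfl : x = ℓ := hx; exact hστ
  ext a
  exact DFunLike.congr_fun hcomp ⟨a, IntermediateField.mem_top⟩

variable {F L : Type*} [Field F] [Field L] [Algebra F K] [Algebra F L] [Algebra K L]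
  [IsScalarTower F K L] {ℓ : L}

theorem exists_eigenvalue_character (hℓ : ℓ ≠ 0) (hσ : ∀ σ : L ≃ₐ[K] L, ∃ c : F, σ ℓ = c • ℓ) :
    ∃ χ : (L ≃ₐ[K] L) →* F, ∀ σ, σ ℓ = χ σ • ℓ := by
  choose χ hχ using hσ
  have hinj : Function.Injective fun c : F => c • ℓ := smul_left_injective F hℓ
  refine ⟨⟨⟨χ, hinj ?_⟩, fun σ τ => hinj ?_⟩, hχ⟩
  · simp only [← hχ, AlgEquiv.one_apply, one_smul]
  · change χ (σ * τ) • ℓ = (χ σ * χ τ) • ℓ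
    rw [← hχ, AlgEquiv.mul_apply, hχ τ, LinearMapClass.map_smul_of_tower, hχ σ, smul_smul, mul_comm]

theorem exists_isKummerSetting_of_adjoin_eq_top [FiniteDimensional K L] [IsGalois K L]
    (htop : K⟮ℓ⟯ = ⊤) (hℓ : ℓ ∉ Set.range (algebraMap K L))
    (hσ : ∀ σ : L ≃ₐ[K] L, ∃ c : F, σ ℓ = c • ℓ) :
    ∃ (n : ℕ) (ζ : F) (τ : L ≃ₐ[K] L), IsKummerSetting n ζ τ ℓ := by
  obtain ⟨χ, hχ⟩ := exists_eigenvalue_character (by rintro rfl; exact hℓ ⟨0, map_zero _⟩) hσ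
  have hinj : Function.Injective χ := fun σ τ hστ =>
    algEquiv_ext_of_adjoin_eq_top htop (by rw [hχ, hχ, hστ])
  have hcyclic : IsCyclic (L ≃ₐ[K] L) := isCyclic_of_injective_ringHom χ hinj
  obtain ⟨τ, hτ⟩ := hcyclic.exists_generator
  have horder : orderOf (χ τ) = Module.finrank K L := by
    rw [orderOf_injective χ hinj, orderOf_eq_card_of_forall_mem_zpowers hτ,
      IsGalois.card_aut_eq_finrank]
  refine ⟨Module.finrank K L, χ τ, τ, ?_, rfl, ‹_›, hτ, horder ▸ .orderOf _, htop, hχ τ⟩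
  refine lt_of_le_of_ne Module.finrank_pos fun hone => hℓ ?_
  rw [← IntermediateField.mem_bot, IntermediateField.bot_eq_top_iff_finrank_eq_one.2 hone.symm]
  exact IntermediateField.mem_top

theorem exists_isKummerSetting_adjoin_simple {M : Type*} [Field M] [Algebra F M] [Algebra K M]
    [IsScalarTower F K M] [FiniteDimensional K M] [IsGalois K M] {h : M}
    (hh : h ∉ Set.range (algebraMap K M)) (hσ : ∀ σ : M ≃ₐ[K] M, ∃ c : F, σ h = c • h) :
    ∃ (n : ℕ) (ζ : F) (τ : K⟮h⟯ ≃ₐ[K] K⟮h⟯),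
      IsKummerSetting n ζ τ (IntermediateField.AdjoinSimple.gen K h) := by
  have : IsGalois K K⟮h⟯ := isGalois_adjoin_simple fun σ => by
    obtain ⟨c, hc⟩ := hσ σ
    rw [hc, ← algebraMap_smul K]
    exact K⟮h⟯.smul_mem (IntermediateField.mem_adjoin_simple_self K h)
  refine exists_isKummerSetting_of_adjoin_eq_top (adjoin_gen_eq_top h) ?_ fun σ => ?_
  · rintro ⟨k, hk⟩
    exact hh ⟨k, congrArg (algebraMap K⟮h⟯ M) hk⟩
  · obtain ⟨c, hc⟩ := hσ (σ.liftNormal M)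
    refine ⟨c, (algebraMap K⟮h⟯ M).injective ?_⟩
    rw [← AlgEquiv.liftNormal_commutes]
    exact hc

end KummerTheory

section Existence

variable {F : Type u} {K : Type v} [Field F] [CharZero F] [Field K] [Algebra F K]

theorem exists_isGalois_smul_map_mem_elemForms {M : Type v} [Field M] [Algebra F M] [Algebra K M]
    [IsScalarTower F K M] [FiniteDimensional K M] {ω : Ω[K⁄F]} {h : M} (hh : h ≠ 0)
    (hhω : h • map F F K M ω ∈ elemForms (⊤ : Submodule F M) ⊤) :
    ∃ (N : Type v) (_ : Field N) (_ : Algebra F N) (_ : Algebra K N) (_ : IsScalarTower F K N),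
      FiniteDimensional K N ∧ IsGalois K N ∧
      ∃ g : N, g ≠ 0 ∧ g • map F F K N ω ∈ elemForms (⊤ : Submodule F N) ⊤ := by
  have : CharZero K := charZero_of_injective_algebraMap (algebraMap F K).injective
  have : Algebra.IsAlgebraic K (AlgebraicClosure M) := .trans K M (AlgebraicClosure M)
  have : IsAlgClosure K (AlgebraicClosure M) := ⟨inferInstance, ‹_›⟩
  have : Normal K (AlgebraicClosure M) := IsAlgClosure.normal _ _
  let N := IntermediateField.normalClosure K M (AlgebraicClosure M)
  have : Normal K N := normalClosure.normal _ _ _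
  let φ : M →ₐ[K] N := IsScalarTower.toAlgHom K M N
  refine ⟨N, inferInstance, inferInstance, inferInstance, (inferInstance : IsScalarTower F K N),
    normalClosure.is_finiteDimensional _ _ _, {}, φ h, (map_ne_zero φ).2 hh, ?_⟩
  rw [← formMap_map φ]
  exact formMap_smul F (φ.restrictScalars F) h _ ▸ formMap_mem_elemForms_top _ hhω

theorem IsExceptionalForm.exists_isKummerSetting [IsAlgClosed F] {ω : Ω[K⁄F]}
    (hω : IsExceptionalForm ω) :
    ∃ (L : Type v) (_ : Field L) (_ : Algebra F L) (_ : Algebra K L) (_ : IsScalarTower F K L)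
      (n : ℕ) (ζ : F) (τ : L ≃ₐ[K] L) (ℓ : L),
      IsKummerSetting n ζ τ ℓ ∧ ℓ • map F F K L ω ∈ elemForms (⊤ : Submodule F L) ⊤ := by
  have : CharZero K := charZero_of_injective_algebraMap (algebraMap F K).injective
  obtain ⟨M₀, _, _, _, _, _, hM₀⟩ := hω.1
  have := Algebra.FormallyEtale.of_isSeparable K M₀
  obtain ⟨h₀, hh₀, hh₀ω⟩ := (hasElementaryRelationOver_iff hω.ne_zero).1 hM₀
  obtain ⟨M, _, _, _, _, _, _, h, hh, hhω⟩ := exists_isGalois_smul_map_mem_elemForms hh₀ hh₀ω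
  have hσ (σ : M ≃ₐ[K] M) : ∃ c : F, σ h = c • h := by
    have hσω := formMap_mem_elemForms_top ((σ : M →ₐ[K] M).restrictScalars F) hhω
    rw [formMap_smul, formMap_map] at hσω
    exact exists_eq_smul_of_smul_mem_elemForms hω.ne_zero hω.not_hasFirstIntegral hh hhω hσω
  have hrange : h ∉ Set.range (algebraMap K M) := by
    rintro ⟨k, rfl⟩
    exact hω.2 ((hasElementaryRelationOver_iff hω.ne_zero).2 ⟨k, ne_zero_of_map hh,
      smul_map_mem_elemForms_of_algebraMap_smul_map_mem hhω⟩)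
  obtain ⟨n, ζ, τ, hset⟩ := exists_isKummerSetting_adjoin_simple hrange hσ
  have := hset.isGalois
  have : IsScalarTower F K⟮h⟯ M := IsScalarTower.of_algebraMap_eq fun c => by
    rw [IsScalarTower.algebraMap_apply F K M, IsScalarTower.algebraMap_apply F K K⟮h⟯,
      ← IsScalarTower.algebraMap_apply K K⟮h⟯ M]
  exact ⟨K⟮h⟯, inferInstance, inferInstance, inferInstance, inferInstance, n, ζ, τ, _, hset,
    smul_map_mem_elemForms_of_algebraMap_smul_map_mem (M := M) hhω⟩

end Existence

section RationalFunctions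

variable {F : Type u} [Field F] {ω : Ω[RatFun F⁄F]}

theorem hasElementaryRelation_iff {M : Type v} [Field M] [Algebra F M] [Algebra (RatFun F) M]
    [IsScalarTower F (RatFun F) M] :
    HasElementaryRelation F M ω ↔ HasElementaryRelationOver M ω := by
  constructor
  · rintro ⟨m, v, c, u, hγ⟩
    exact ⟨_, mem_elemForms_top_iff.2 ⟨m, v, c, u, rfl⟩, hγ⟩
  · rintro ⟨γ, hγ, h⟩
    obtain ⟨m, v, c, u, rfl⟩ := mem_elemForms_top_iff.1 hγ
    exact ⟨m, v, c, u, h⟩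

theorem isExceptional_iff : IsExceptional F ω ↔ IsExceptionalForm ω := by
  simp only [IsExceptional, IsExceptionalForm, hasElementaryRelation_iff]

variable {L : Type v} [Field L] [Algebra F L] [Algebra (RatFun F) L]

theorem isTraceNormForm_iff [IsScalarTower F (RatFun F) L] {γ : Ω[L⁄F]} :
    IsTraceNormForm γ ↔ γ ∈ traceNormForms F (RatFun F) L := by
  simp [IsTraceNormForm, traceNormForms, mem_elemForms_iff, MonoidHom.mem_ker, Units.ext_iff]

theorem isCyclicSetting_iff {n : ℕ} {ζ : F} {τ : L ≃ₐ[RatFun F] L} {ℓ : L} :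
    IsCyclicSetting n ζ τ ℓ ↔ IsKummerSetting n ζ τ ℓ :=
  ⟨fun h => ⟨h.1, h.2, h.3, h.4, h.5, h.6, h.7⟩, fun h => ⟨h.1, h.2, h.3, h.4, h.5, h.6, h.7⟩⟩

end RationalFunctions

end ElemInt

end

theorem mainTheorem5_general {F : Type u} [Field F] [IsAlgClosed F] [CharZero F] {K : Type v}
    [Field K] [Algebra F K] :
    (∀ (L : Type v) [Field L] [Algebra F L] [Algebra K L] [IsScalarTower F K L]
        (n : ℕ) (ζ : F) (τ : L ≃ₐ[K] L) (ℓ : L), ElemInt.IsKummerSetting n ζ τ ℓ →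
        (∀ γ' ∈ ElemInt.traceNormForms F K L,
          ElemInt.kummerProj n ζ τ γ' ∈ ElemInt.traceNormForms F K L ∧
          ∃ ω : Ω[K⁄F],
            ElemInt.kummerProj n ζ τ γ' = ℓ • KaehlerDifferential.map F F K L ω) ∧
        (∀ γ' ∈ ElemInt.traceNormForms F K L, ∀ ω : Ω[K⁄F],
          ElemInt.kummerProj n ζ τ γ' = ℓ • KaehlerDifferential.map F F K L ω →
          ¬ ElemInt.HasFirstIntegral ω → ElemInt.IsExceptionalForm ω) ∧
        (∀ ω : Ω[K⁄F], ℓ • KaehlerDifferential.map F F K L ω ∈ ElemInt.elemForms ⊤ ⊤ →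
          ∃ γ' ∈ ElemInt.traceNormForms F K L,
            ElemInt.kummerProj n ζ τ γ' = ℓ • KaehlerDifferential.map F F K L ω)) ∧
    (∀ ω : Ω[K⁄F], ElemInt.IsExceptionalForm ω →
      ∃ (L : Type v) (_ : Field L) (_ : Algebra F L) (_ : Algebra K L) (_ : IsScalarTower F K L)
        (n : ℕ) (ζ : F) (τ : L ≃ₐ[K] L) (ℓ : L) (γ' : Ω[L⁄F]),
        ElemInt.IsKummerSetting n ζ τ ℓ ∧ γ' ∈ ElemInt.traceNormForms F K L ∧
          ElemInt.kummerProj n ζ τ γ' = ℓ • KaehlerDifferential.map F F K L ω) := by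
  refine ⟨fun L _ _ _ _ n ζ τ ℓ h => ⟨fun γ' hγ' => ?_, fun γ' hγ' ω hω hint => ?_, fun ω hω => ?_⟩,
    fun ω hω => ?_⟩
  · exact ⟨ElemInt.kummerProj_mem_traceNormForms n ζ τ hγ', h.exists_kummerProj_eq_smul γ'⟩
  · have hγ := ElemInt.kummerProj_mem_traceNormForms n ζ τ hγ'
    exact h.isExceptionalForm hint (hω ▸ ElemInt.traceNormForms_le_elemForms hγ)
  · exact ⟨_, h.smul_map_mem_traceNormForms hω, h.kummerProj_smul_map ω⟩
  · obtain ⟨L, _, _, _, _, n, ζ, τ, ℓ, h, hℓω⟩ := hω.exists_isKummerSetting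
    exact ⟨L, _, _, _, _, n, ζ, τ, ℓ, _, h, h.smul_map_mem_traceNormForms hℓω,
      h.kummerProj_smul_map ω⟩

theorem mainTheorem5 {F : Type u} [Field F] [IsAlgClosed F] [CharZero F] :
    (∀ (L : Type u) [Field L] [Algebra F L] [Algebra (ElemInt.RatFun F) L]
        [IsScalarTower F (ElemInt.RatFun F) L]
        (n : ℕ) (ζ : F) (τ : L ≃ₐ[ElemInt.RatFun F] L) (ℓ : L),
        ElemInt.IsCyclicSetting n ζ τ ℓ →
        (∀ γ' : Ω[L⁄F], ElemInt.IsTraceNormForm γ' →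
          ElemInt.IsTraceNormForm (ElemInt.Pr n ζ τ γ') ∧
          ∃ ω : Ω[ElemInt.RatFun F⁄F],
            ElemInt.Pr n ζ τ γ' = ℓ • ElemInt.extendForm F L ω) ∧
        (∀ (γ' : Ω[L⁄F]) (ω : Ω[ElemInt.RatFun F⁄F]), ElemInt.IsTraceNormForm γ' →
          ElemInt.Pr n ζ τ γ' = ℓ • ElemInt.extendForm F L ω →
          ¬ ElemInt.HasRationalFirstIntegral F ω → ElemInt.IsExceptional F ω) ∧
        (∀ ω : Ω[ElemInt.RatFun F⁄F], ElemInt.IsExceptional F ω →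
          (∃ (m : ℕ) (v : L) (c : Fin m → F) (u : Fin m → Lˣ),
            ElemInt.elemForm v c u = ℓ • ElemInt.extendForm F L ω) →
          ∃ γ' : Ω[L⁄F], ElemInt.IsTraceNormForm γ' ∧
            ElemInt.Pr n ζ τ γ' = ℓ • ElemInt.extendForm F L ω)) ∧
    (∀ ω : Ω[ElemInt.RatFun F⁄F], ElemInt.IsExceptional F ω →
      ∃ (L : Type u) (_ : Field L) (_ : Algebra F L) (_ : Algebra (ElemInt.RatFun F) L)
        (_ : IsScalarTower F (ElemInt.RatFun F) L)
        (n : ℕ) (ζ : F) (τ : L ≃ₐ[ElemInt.RatFun F] L) (ℓ : L) (γ' : Ω[L⁄F]),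
        ElemInt.IsCyclicSetting n ζ τ ℓ ∧ ElemInt.IsTraceNormForm γ' ∧
          ElemInt.Pr n ζ τ γ' = ℓ • ElemInt.extendForm F L ω) := by
  obtain ⟨hsetting, hexists⟩ := mainTheorem5_general (F := F) (K := ElemInt.RatFun F)
  simp only [ElemInt.isCyclicSetting_iff, ElemInt.isTraceNormForm_iff, ElemInt.isExceptional_iff,
    ← ElemInt.mem_elemForms_top_iff]
  refine ⟨fun L _ _ _ _ n ζ τ ℓ h => ?_, hexists⟩
  obtain ⟨ha, hb, hc⟩ := hsetting L n ζ τ ℓ h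
  exact ⟨ha, fun γ' ω hγ' => hb γ' hγ' ω, fun ω _ => hc ω⟩
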